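/- Let $S$ be a commutative $*$-semigroup with neutral element $0$, i.e. a commutative semigroup, written additively, with an involution $*$ satisfying $(s+t)^*=s^*+t^*$ and $(s^*)^*=s$. A character on $S$ is a nonzero function $\sigma:S\to\mathbb C$ with $\sigma(s+t)=\sigma(s)\sigma(t)$ and $\sigma(s^*)=\overline{\sigma(s)}$ for all $s,t\in S$; let $S^*$ be the set of characters, with the least $\sigma$-algebra making all evaluations $\sigma\mapsto\sigma(s)$ measurable. Write $s\sim t$ if $\sigma(s)=\sigma(t)$ for all $\sigma\in S^*$; the quotient $S/{\sim}$ is again a commutative $*$-semigroup with neutral element, and $[s]$ denotes the class of $s$. A function $\phi:S\to\mathbb C$ is positive definite, $\phi\in\mathfrak P(S)$, if $\sum_{i,j=0}^N\xi_i\overline{\xi_j}\,\phi(s_j^*+s_i)\ge 0$ for all $N\ge 0$, $s_0,\dots,s_N\in S$, $\xi_0,\dots,\xi_N\in\mathbb C$. It is a moment function, $\phi\in\mathfrak M(S)$, if there is a positive measure $\mu$ on $S^*$ such that all evaluations $\sigma\mapsto\sigma(s)$ are $\mu$-square-integrable and $\phi(s)=\int_{S^*}\sigma(s)\,d\mu(\sigma)$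 for all $s\in S$; then $\phi\in\mathfrak P(S)$. For $\phi\in\mathfrak P(S)$ let $\mathcal H^\phi\subseteq\mathbb C^S$ be the reproducing kernel Hilbert space with kernel $K^\phi(s,t)=\phi(t^*+s)$, let $K_s^\phi=K^\phi(\cdot,s)$, and for $u\in S$ let $u_\phi$ be the closure in $\mathcal H^\phi$ of the (well defined, closable) operator $\sum_j\xi_jK^\phi_{s_j}\mapsto\sum_j\xi_jK^\phi_{s_j+u}$ with domain $\operatorname{lin}\{K_s^\phi:s\in S\}$. The same notions are used for $S/{\sim}$ in place of $S$. Let $I$ denote the identity operator. Corollary 3. Let $u\in S$ be such that $[2u]=0$ and $[u]=[u^*]$ in $S/{\sim}$. Then $$\dim\ker(u_\phi+I)<\infty\ \text{ for every }\phi\in\mathfrak P(S)\iff \dim\ker([u]_\psi+I)<\infty\ \text{ for every }\psi\in\mathfrak P(S/{\sim}),$$ and likewise $$\dim\ker(u_\phi+I)<\infty\ \text{ for every }\phi\in\mathfrak M(S)\iff \dim\ker([u]_\psi+I)<\infty\ \text{ for every }\psi\in\mathfrak M(S/{\sim}).$$ -/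

import Mathlib

open scoped ComplexConjugate ComplexOrder

noncomputable section

namespace StarSemigroup

/-! A commutative `*`-semigroup with neutral element is a type `S` with
`[AddCommMonoid S] [StarAddMonoid S]`. -/

/-- A character on a `*`-semigroup `S`: a nonzero function `χ : S → ℂ` that carries addition to
multiplication and the involution to complex conjugation. -/
@[ext]
structure Character (S : Type*) [Add S] [Star S] where
  toFun : S → ℂ
  map_add' : ∀ s t, toFun (s + t) = toFun s * toFun t
  map_star' : ∀ s, toFun (star s) = conj (toFun s)
  ne_zero' : toFun ≠ 0

instance (S : Type*) [Add S] [Star S] : CoeFun (Character S) (fun _ => S → ℂ) :=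
  ⟨Character.toFun⟩

/-- The least `σ`-algebra on the set of characters that makes all evaluations `χ ↦ χ s`
measurable. -/
instance (S : Type*) [Add S] [Star S] : MeasurableSpace (Character S) :=
  ⨆ s : S, MeasurableSpace.comap (fun χ : Character S => χ s) (borel ℂ)

lemma Character.measurable_eval {S : Type*} [Add S] [Star S] (s : S) :
    Measurable (fun χ : Character S => χ s) := by
  rw [measurable_iff_comap_le, BorelSpace.measurable_eq (α := ℂ)]
  exact le_iSup (fun s : S => MeasurableSpace.comap (fun χ : Character S => χ s) (borel ℂ)) s

/-- The relation `s ∼ t` iff `σ s = σ t` for every character `σ`; it is a congruence. -/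
def charCon (S : Type*) [Add S] [Star S] : AddCon S where
  r s t := ∀ σ : Character S, σ s = σ t
  iseqv := ⟨fun _ _ => rfl, fun h σ => (h σ).symm, fun h k σ => (h σ).trans (k σ)⟩
  add' h k σ := by rw [σ.map_add', σ.map_add', h σ, k σ]

/-- The greatest `*`-homomorphic `*`-separative image `S/∼`. -/
abbrev SepQuotient (S : Type*) [Add S] [Star S] : Type _ := (charCon S).Quotient

/-- The class `[s]` of `s` in `S/∼`. -/
def cls {S : Type*} [Add S] [Star S] (s : S) : SepQuotient S := (s : (charCon S).Quotient)

/-- The involution on `S/∼`, given by `[s]* = [s*]`. -/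
instance (S : Type*) [AddCommMonoid S] [StarAddMonoid S] : StarAddMonoid (SepQuotient S) where
  star := Quotient.map' star (fun s t h σ => by
    rw [σ.map_star', σ.map_star']; exact congrArg _ (h σ))
  star_involutive := by
    rintro ⟨s⟩
    exact congrArg (fun x : S => (x : (charCon S).Quotient)) (star_star s)
  star_add := by
    rintro ⟨s⟩ ⟨t⟩
    exact congrArg (fun x : S => (x : (charCon S).Quotient)) (star_add s t)

section Functions

variable {S : Type*} [AddCommMonoid S] [StarAddMonoid S]

/-- Positive definite functions on `S`. (For complex numbers, `0 ≤ z` means that `z` is real and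
nonnegative.) -/
def IsPosDef (φ : S → ℂ) : Prop :=
  ∀ (N : ℕ) (s : Fin (N + 1) → S) (ξ : Fin (N + 1) → ℂ),
    0 ≤ ∑ i, ∑ j, ξ i * conj (ξ j) * φ (star (s j) + s i)

/-- Moment functions on `S`: `φ s = ∫ σ(s) dμ(σ)` for a positive measure `μ` on the set of
characters for which all evaluations are square-integrable. -/
def IsMoment (φ : S → ℂ) : Prop :=
  ∃ μ : MeasureTheory.Measure (Character S),
    (∀ s : S, MeasureTheory.MemLp (fun σ : Character S => σ s) 2 μ) ∧
      ∀ s : S, φ s = ∫ σ : Character S, σ s ∂μ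

/-- Every moment function is positive definite. -/
lemma IsMoment.isPosDef {φ : S → ℂ} (h : IsMoment φ) : IsPosDef φ := by
  obtain ⟨μ, hμ, hφ⟩ := h
  intro N s ξ
  have hint : ∀ i j : Fin (N + 1), MeasureTheory.Integrable
      (fun σ : Character S => ξ i * conj (ξ j) * σ (star (s j) + s i)) μ := by
    intro i j
    have h1 := ((hμ (star (s j))).integrable_mul (hμ (s i))).const_mul (ξ i * conj (ξ j))
    refine h1.congr (Filter.Eventually.of_forall fun σ => ?_)
    simp [σ.map_add']
  have key : ∑ i, ∑ j, ξ i * conj (ξ j) * φ (star (s j) + s i)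
      = ∫ σ : Character S, ((‖∑ i, ξ i * σ (s i)‖ ^ 2 : ℝ) : ℂ) ∂μ := by
    have e : ∀ σ : Character S, ((‖∑ i, ξ i * σ (s i)‖ ^ 2 : ℝ) : ℂ)
        = ∑ i, ∑ j, ξ i * conj (ξ j) * σ (star (s j) + s i) := by
      intro σ
      rw [Complex.ofReal_pow, ← Complex.mul_conj', map_sum, Finset.sum_mul_sum]
      refine Finset.sum_congr rfl fun i _ => Finset.sum_congr rfl fun j _ => ?_
      rw [σ.map_add', σ.map_star', map_mul]
      ring
    simp_rw [e]
    rw [MeasureTheory.integral_finsetSum _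
      fun i _ => MeasureTheory.integrable_finsetSum _ fun j _ => hint i j]
    refine Finset.sum_congr rfl fun i _ => ?_
    rw [MeasureTheory.integral_finsetSum _ fun j _ => hint i j]
    refine Finset.sum_congr rfl fun j _ => ?_
    rw [MeasureTheory.integral_const_mul, hφ]
  rw [key, integral_complex_ofReal]
  exact Complex.zero_le_real.mpr (MeasureTheory.integral_nonneg fun σ => by positivity)

/-- The scalar kernel `K(s, t) = φ (t* + s)`, as a matrix of operators on `ℂ`. -/
def kernelMatrix (φ : S → ℂ) : Matrix S S (ℂ →L[ℂ] ℂ) :=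
  Matrix.of fun s t => φ (star t + s) • ContinuousLinearMap.id ℂ ℂ

lemma IsPosDef.conj_symm {φ : S → ℂ} (h : IsPosDef φ) (s t : S) :
    conj (φ (star s + t)) = φ (star t + s) := by
  have h0 := (Complex.le_def.1 (h 0 ![s] ![1])).2
  have h1 := (Complex.le_def.1 (h 0 ![t] ![1])).2
  have h2 := (Complex.le_def.1 (h 1 ![s, t] ![1, 1])).2
  have h3 := (Complex.le_def.1 (h 1 ![s, t] ![1, Complex.I])).2
  simp [Fin.sum_univ_succ] at h0 h1 h2 h3
  apply Complex.ext
  · simp only [Complex.conj_re]; linarith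
  · simp only [Complex.conj_im]; linarith

lemma IsPosDef.posSemidef {φ : S → ℂ} (h : IsPosDef φ) : (kernelMatrix φ).PosSemidef := by
  have tfae := (RKHS.posSemidef_tfae (K := kernelMatrix φ)).out 0 2
  refine tfae.mpr ⟨?_, fun v => ?_⟩
  · ext s t
    simp [kernelMatrix, Matrix.conjTranspose_apply, ContinuousLinearMap.star_eq_adjoint,
      h.conj_symm, ContinuousLinearMap.adjoint_id]
  · have hfin : ∀ T : Finset S,
        0 ≤ ∑ x ∈ T, ∑ y ∈ T, conj (v x) * v y * φ (star y + x) := by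
      intro T
      obtain ⟨n, hn⟩ : ∃ n, T.card = n := ⟨_, rfl⟩
      have e := T.equivFinOfCardEq hn
      cases n with
      | zero => simp [Finset.card_eq_zero.mp hn]
      | succ N =>
        have h1 := h N (fun i => (e.symm i : S)) (fun i => conj (v (e.symm i : S)))
        rw [← Finset.sum_coe_sort T, ← e.symm.sum_comp]
        refine h1.trans_eq (Finset.sum_congr rfl fun i _ => ?_)
        rw [← Finset.sum_coe_sort T, ← e.symm.sum_comp]
        simp
    have h2 := (Complex.le_def.1 (hfin v.support)).1
    rw [Complex.zero_re, Finset.sum_comm, ← Complex.conj_re (Finset.sum _ _), map_sum] at h2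
    refine h2.trans_eq ?_
    simp only [Finsupp.sum, RCLike.re_to_complex]
    refine congrArg Complex.re (Finset.sum_congr rfl fun x _ => ?_)
    rw [map_sum]
    refine Finset.sum_congr rfl fun y _ => ?_
    simp [kernelMatrix]
    ring

/-- The type `𝔓(S)` of positive definite functions on `S`. -/
abbrev PosDefFun (S : Type*) [AddCommMonoid S] [StarAddMonoid S] := {φ : S → ℂ // IsPosDef φ}

instance (φ : PosDefFun S) : Fact (kernelMatrix φ.1).PosSemidef := ⟨φ.2.posSemidef⟩

/-- The reproducing kernel Hilbert space `H^φ` of a positive definite function `φ`: the Hilbert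
space of functions on `S` with reproducing kernel `K(s, t) = φ (t* + s)`. -/
abbrev HilbertSpace (φ : PosDefFun S) : Type _ := RKHS.OfKernel (kernelMatrix φ.1)

/-- The kernel function `K_s = K(·, s)`, as an element of `H^φ`. -/
def kerVec (φ : PosDefFun S) (s : S) : HilbertSpace φ := RKHS.kerFun (HilbertSpace φ) s 1

lemma kerVec_apply (φ : PosDefFun S) (s t : S) : kerVec φ s t = φ.1 (star s + t) := by
  rw [kerVec, RKHS.kerFun_apply, RKHS.OfKernel.kernel_ofKernel]
  simp [kernelMatrix]

/-- The reproducing property (Mathlib's inner product is conjugate-linear on the left). -/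
lemma inner_kerVec (φ : PosDefFun S) (s : S) (f : HilbertSpace φ) :
    inner ℂ (kerVec φ s) f = f s := by
  simp [kerVec]

/-- The graph of the operator `∑ ξ_j K_{s_j} ↦ ∑ ξ_j K_{s_j + u}`. -/
def shiftGraph (u : S) (φ : PosDefFun S) : Submodule ℂ (HilbertSpace φ × HilbertSpace φ) :=
  Submodule.span ℂ (Set.range fun s : S => (kerVec φ s, kerVec φ (s + u)))

/-- The operator `A(u, φ)`, with domain the linear span of the `K_s`,
`∑ ξ_j K_{s_j} ↦ ∑ ξ_j K_{s_j + u}`. -/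
def shiftOp (u : S) (φ : PosDefFun S) : HilbertSpace φ →ₗ.[ℂ] HilbertSpace φ :=
  (shiftGraph u φ).toLinearPMap

lemma apply_of_mem_closure_shiftGraph {u : S} {φ : PosDefFun S}
    {p : HilbertSpace φ × HilbertSpace φ} (hp : p ∈ (shiftGraph u φ).topologicalClosure) (x : S) :
    p.2 x = p.1 (x + star u) := by
  let G : Submodule ℂ (HilbertSpace φ × HilbertSpace φ) :=
    { carrier := {p | p.2 x = p.1 (x + star u)}
      zero_mem' := by simp
      add_mem' := by
        intro a b ha hb
        simp only [Set.mem_ofPred_eq] at ha hb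
        simp [ha, hb]
      smul_mem' := by
        intro c a ha
        simp only [Set.mem_ofPred_eq] at ha
        simp [ha] }
  have hG : IsClosed (G : Set (HilbertSpace φ × HilbertSpace φ)) :=
    isClosed_eq ((RKHS.continuous_eval x).comp continuous_snd)
      ((RKHS.continuous_eval (x + star u)).comp continuous_fst)
  refine Submodule.topologicalClosure_minimal _ (Submodule.span_le.2 ?_) hG hp
  rintro _ ⟨s, rfl⟩
  change kerVec φ (s + u) x = kerVec φ s (x + star u)
  rw [kerVec_apply, kerVec_apply, star_add, add_assoc, add_comm (star u) x]

lemma closure_shiftGraph_functional (u : S) (φ : PosDefFun S)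
    (p : HilbertSpace φ × HilbertSpace φ) (hp : p ∈ (shiftGraph u φ).topologicalClosure)
    (h0 : p.1 = 0) : p.2 = 0 := by
  refine RKHS.ext fun x => ?_
  rw [apply_of_mem_closure_shiftGraph hp, h0]
  simp

/-- `A(u, φ)` is well defined: its graph is the span of the pairs `(K_s, K_{s + u})`. -/
lemma graph_shiftOp (u : S) (φ : PosDefFun S) : (shiftOp u φ).graph = shiftGraph u φ :=
  Submodule.toLinearPMap_graph_eq _ fun p hp h0 =>
    closure_shiftGraph_functional u φ p (Submodule.le_topologicalClosure _ hp) h0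

/-- `A(u, φ)` is closable. -/
lemma isClosable_shiftOp (u : S) (φ : PosDefFun S) : (shiftOp u φ).IsClosable := by
  refine ⟨(shiftGraph u φ).topologicalClosure.toLinearPMap, ?_⟩
  rw [graph_shiftOp, Submodule.toLinearPMap_graph_eq _ (closure_shiftGraph_functional u φ)]

/-- The shift operator `u_φ`: the closure of `A(u, φ)`. -/
def shift (u : S) (φ : PosDefFun S) : HilbertSpace φ →ₗ.[ℂ] HilbertSpace φ :=
  (shiftOp u φ).closure

/-- `ker (u_φ + I)`, as a subspace of `H^φ`. -/
def kerShiftAddOne (u : S) (φ : PosDefFun S) : Submodule ℂ (HilbertSpace φ) where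
  carrier := {f | ∃ hf : f ∈ (shift u φ).domain, shift u φ ⟨f, hf⟩ + f = 0}
  zero_mem' := ⟨Submodule.zero_mem _, by
    rw [add_zero]; exact (shift u φ).map_zero⟩
  add_mem' := by
    rintro f g ⟨hf, hf0⟩ ⟨hg, hg0⟩
    refine ⟨Submodule.add_mem _ hf hg, ?_⟩
    have := (shift u φ).map_add ⟨f, hf⟩ ⟨g, hg⟩
    rw [AddMemClass.mk_add_mk] at this
    rw [this, add_add_add_comm, hf0, hg0, add_zero]
  smul_mem' := by
    rintro c f ⟨hf, hf0⟩
    refine ⟨Submodule.smul_mem _ c hf, ?_⟩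
    have := (shift u φ).map_smul c ⟨f, hf⟩
    rw [SetLike.mk_smul_mk] at this
    rw [this, ← smul_add, hf0, smul_zero]

end Functions

end StarSemigroup

end

open StarSemigroup

/-! The point is that every positive definite `φ` is constant on the classes of `∼`. Then `φ = ψ ∘
cls`, the vectors `K_s` and `K_[s]` have equal Gram matrices, and the resulting unitary carries the
graph of one shift onto that of the other, hence one kernel onto the other. Moment functions
correspond by pushing measures forward between the two sets of characters.

For constancy (`kerVec_eq_of_forall_character`), let all characters agree at `s` and `t`. Indicators
of faces are characters, so `s` and `t` generate the same face. In its Grothendieck group `s - t` is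
torsion and has the form `(a + a*) - (b + b*)`. Formally the quotient of the operators of `s` and
`t` is therefore positive and of finite order, so it is the identity. `kerMap_mon_mul_eq` makes this
precise without inverses or unbounded operators, working modulo the null space of `kerMap` in the
semigroup algebra and cancelling elements of the face behind the factor `s + s*`. -/

open Algebra in
theorem Algebra.GrothendieckAddGroup.of_eq_of_iff {M : Type*} [AddCommMonoid M] {x y : M} :
    GrothendieckAddGroup.of x = GrothendieckAddGroup.of y ↔ ∃ c, x + c = y + c := by
  refine ((AddLocalization.addMonoidOf (⊤ : AddSubmonoid M)).eq_iff_exists).trans ⟨?_, ?_⟩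
  · rintro ⟨c, hc⟩
    exact ⟨c, by rwa [add_comm x, add_comm y]⟩
  · rintro ⟨c, hc⟩
    exact ⟨⟨c, trivial⟩, by simpa only [add_comm] using hc⟩

/-- An element of an abelian group killed by all real-valued homomorphisms is torsion. -/
theorem exists_nsmul_eq_zero_of_forall_real {G : Type*} [AddCommGroup G] {g : G}
    (h : ∀ f : G →+ ℝ, f g = 0) : ∃ n : ℕ, 0 < n ∧ n • g = 0 := by
  by_contra! hn
  have hinj : Function.Injective (zmultiplesHom G g) := by
    rw [injective_iff_map_eq_zero]
    intro k hk
    by_contra hk0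
    refine hn k.natAbs (Int.natAbs_pos.2 hk0) ?_
    rw [zmultiplesHom_apply] at hk
    rcases Int.natAbs_eq k with e | e
    · rw [← natCast_zsmul, ← e, hk]
    · rw [← natCast_zsmul, ← neg_eq_zero, ← neg_zsmul, ← e, hk]
  obtain ⟨f, hf⟩ := Module.Baer.extension_property_addMonoidHom (Module.Baer.of_divisible ℝ)
    (zmultiplesHom G g) hinj (Int.castAddHom ℝ)
  have h1 := DFunLike.congr_fun hf 1
  simp [h f] at h1

/-- Characters into the circle separate the points of a (discrete) abelian group. -/
theorem exists_addChar_circle_ne_one {G : Type*} [AddCommGroup G] {g : G} (hg : g ≠ 0) :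
    ∃ χ : AddChar G Circle, χ g ≠ 1 := by
  obtain ⟨c, hc⟩ := CharacterModule.exists_character_apply_ne_zero_of_ne_zero hg
  let ι : AddCircle (1 : ℚ) →+ AddCircle (1 : ℝ) :=
    QuotientAddGroup.map _ _ ((Rat.castHom ℝ : ℚ →+* ℝ) : ℚ →+ ℝ) (by
      rw [AddSubgroup.zmultiples_le]
      exact AddSubgroup.mem_zmultiples_iff.2 ⟨1, by simp⟩)
  have hι : ∀ x, ι x = 0 → x = 0 := by
    intro x
    induction x using QuotientAddGroup.induction_on with
    | H q =>
      intro hq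
      have hq' : ((q : ℝ) : AddCircle (1 : ℝ)) = 0 := hq
      rw [AddCircle.coe_eq_zero_iff] at hq'
      obtain ⟨n, hn⟩ := hq'
      refine (AddCircle.coe_eq_zero_iff (1 : ℚ)).2 ⟨n, ?_⟩
      rw [zsmul_one] at hn ⊢
      exact_mod_cast hn
  refine ⟨⟨fun x => AddCircle.toCircle (ι (c x)), ?_, fun a b => ?_⟩, fun h => hc (hι _ ?_)⟩
  · rw [map_zero, map_zero, AddCircle.toCircle_zero]
  · rw [map_add, map_add, AddCircle.toCircle_add]
  · exact AddCircle.injective_toCircle one_ne_zero (h.trans AddCircle.toCircle_zero.symm)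

namespace StarSemigroup

/-! ### Characters without zeros and the Grothendieck group -/

section Grothendieck

open Algebra

variable {M : Type*} [AddCommMonoid M] [StarAddMonoid M]

/-- A character without zeros, from a real-valued homomorphism `f`: `x ↦ exp (f x + f x*)`. -/
noncomputable def Character.ofReal (f : GrothendieckAddGroup M →+ ℝ) : Character M where
  toFun x := (Real.exp (f (.of x) + f (.of (star x))) : ℝ)
  map_add' x y := by
    rw [← Complex.ofReal_mul, ← Real.exp_add, star_add, map_add, map_add, map_add, map_add]
    congr 2
    ring
  map_star' x := by rw [Complex.conj_ofReal, star_star, add_comm]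
  ne_zero' h := by simpa using congrFun h 0

/-- A unimodular character, from a circle-valued one killing all elements `x + x*`. -/
noncomputable def Character.ofCircle (χ : AddChar (GrothendieckAddGroup M) Circle)
    (hχ : ∀ x : M, χ (.of (x + star x)) = 1) : Character M where
  toFun x := χ (.of x)
  map_add' x y := by rw [map_add, AddChar.map_add_eq_mul, Circle.coe_mul]
  map_star' x := by
    have h := hχ x
    rw [map_add, AddChar.map_add_eq_mul] at h
    rw [← Circle.coe_inv_eq_conj, eq_inv_of_mul_eq_one_right h]
  ne_zero' h := by simpa using congrFun h 0

/-- The characters `Character.ofReal f` detect the value of every real homomorphism `f` at this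
difference. -/
theorem exists_nsmul_of_forall_character {s t : M} (h : ∀ σ : Character M, σ s = σ t) :
    ∃ n : ℕ, 0 < n ∧ n • (GrothendieckAddGroup.of (s + star s) - .of (t + star t)) = 0 := by
  refine exists_nsmul_eq_zero_of_forall_real fun f => ?_
  have h1 := h (.ofReal f)
  simp only [Character.ofReal, Complex.ofReal_inj, Real.exp_eq_exp] at h1
  rw [map_sub, map_add, map_add, map_add, map_add, h1, sub_self]

/-- The differences on the right form a subgroup `H`. A circle-valued character of the quotient by
`H` sends `x*` to the inverse of the value at `x`, which is its conjugate, so it induces a character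
of `M`; such characters separate the points of the quotient. -/
theorem exists_sub_eq_of_forall_character {s t : M} (h : ∀ σ : Character M, σ s = σ t) :
    ∃ a b : M, GrothendieckAddGroup.of s - .of t
      = GrothendieckAddGroup.of (a + star a) - .of (b + star b) := by
  let H : AddSubgroup (GrothendieckAddGroup M) :=
    { carrier := {g | ∃ a b : M, g
        = GrothendieckAddGroup.of (a + star a) - .of (b + star b)}
      zero_mem' := ⟨0, 0, by simp⟩
      add_mem' := by
        rintro _ _ ⟨a, b, rfl⟩ ⟨a', b', rfl⟩
        refine ⟨a + a', b + b', ?_⟩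
        simp only [star_add, map_add]
        abel
      neg_mem' := by
        rintro _ ⟨a, b, rfl⟩
        exact ⟨b, a, by simp⟩ }
  change GrothendieckAddGroup.of s - .of t ∈ H
  by_contra hH
  rw [← QuotientAddGroup.eq_zero_iff] at hH
  obtain ⟨χ, hχ⟩ := exists_addChar_circle_ne_one hH
  refine hχ ?_
  have h1 := h (.ofCircle (χ.compAddMonoidHom (QuotientAddGroup.mk' H)) fun x => ?_)
  · have h2 := Circle.coe_injective h1
    simp only [AddChar.compAddMonoidHom_apply, QuotientAddGroup.mk'_apply] at h2
    rw [QuotientAddGroup.mk_sub, AddChar.map_sub_eq_div, h2, div_self']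
  · rw [AddChar.compAddMonoidHom_apply, QuotientAddGroup.mk'_apply,
      (QuotientAddGroup.eq_zero_iff _).2 (show _ ∈ H from ⟨x, 0, by simp⟩), AddChar.map_zero_eq_one]

/-- Elements with the same values under all characters differ in the Grothendieck group by a
torsion element. -/
theorem exists_nsmul_sub_eq_zero_of_forall_character {s t : M}
    (h : ∀ σ : Character M, σ s = σ t) :
    ∃ n : ℕ, 0 < n ∧ n • (GrothendieckAddGroup.of s - .of t) = 0 := by
  obtain ⟨n, hn, h1⟩ := exists_nsmul_of_forall_character h
  obtain ⟨a, b, h2⟩ := exists_sub_eq_of_forall_character h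
  -- The form of `s - t` found in `h2` is invariant under the involution. Hence the torsion element
  -- of `h1` equals `2(s - t)`.
  have h3 : GrothendieckAddGroup.of (star s) - .of (star t)
      = GrothendieckAddGroup.of s - .of t := by
    rw [h2]
    rw [sub_eq_sub_iff_add_eq_add, ← map_add, ← map_add,
      GrothendieckAddGroup.of_eq_of_iff] at h2 ⊢
    obtain ⟨c, hc⟩ := h2
    refine ⟨star c, ?_⟩
    have := congrArg star hc
    simpa [star_add, add_comm] using this
  refine ⟨n * 2, by positivity, ?_⟩
  rw [mul_nsmul', two_nsmul]
  nth_rewrite 2 [← h3]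
  rw [← h1, map_add, map_add]
  congr 1
  abel

end Grothendieck

/-! ### Faces and extension of characters by zero -/

section Face

variable {S : Type*} [AddCommMonoid S] [StarAddMonoid S]

/-- The smallest star-invariant face of `S` containing `s`. -/
def face (s : S) : AddSubmonoid S where
  carrier := {x | ∃ (y : S) (k : ℕ), x + y = k • (s + star s)}
  zero_mem' := ⟨0, 0, by simp⟩
  add_mem' := by
    rintro a b ⟨y, k, h⟩ ⟨y', k', h'⟩
    exact ⟨y + y', k + k', by rw [add_add_add_comm, h, h', add_nsmul]⟩

theorem self_mem_face (s : S) : s ∈ face s := ⟨star s, 1, by simp⟩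

theorem star_mem_face {s x : S} (h : x ∈ face s) : star x ∈ face s := by
  obtain ⟨y, k, h⟩ := h
  exact ⟨star y, k, by rw [← star_add, h, star_nsmul, star_add, star_star, add_comm s]⟩

theorem left_mem_face {s x y : S} (h : x + y ∈ face s) : x ∈ face s := by
  obtain ⟨z, k, h⟩ := h
  exact ⟨y + z, k, by rw [← add_assoc, h]⟩

theorem add_mem_face_iff {s x y : S} : x + y ∈ face s ↔ x ∈ face s ∧ y ∈ face s :=
  ⟨fun h => ⟨left_mem_face h, left_mem_face (add_comm x y ▸ h)⟩, fun h => add_mem h.1 h.2⟩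

theorem star_mem_face_iff {s x : S} : star x ∈ face s ↔ x ∈ face s :=
  ⟨fun h => star_star x ▸ star_mem_face h, star_mem_face⟩

instance (s : S) : StarAddMonoid (face s) where
  star x := ⟨star x.1, star_mem_face x.2⟩
  star_involutive x := Subtype.ext (star_star x.1)
  star_add x y := Subtype.ext (star_add x.1 y.1)

@[simp] theorem coe_star_face {s : S} (x : face s) : ((star x : face s) : S) = star (x : S) := rfl

open Classical in
/-- Extension of a character of a face by zero. -/
noncomputable def Character.extendFace {s : S} (χ : Character (face s)) : Character S where
  toFun x := if h : x ∈ face s then χ ⟨x, h⟩ else 0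
  map_add' x y := by
    by_cases hx : x ∈ face s
    · by_cases hy : y ∈ face s
      · rw [dif_pos hx, dif_pos hy, dif_pos (add_mem hx hy), ← χ.map_add']
        rfl
      · rw [dif_neg hy, dif_neg (fun h => hy (add_mem_face_iff.1 h).2), mul_zero]
    · rw [dif_neg hx, dif_neg (fun h => hx (add_mem_face_iff.1 h).1), zero_mul]
  map_star' x := by
    by_cases hx : x ∈ face s
    · rw [dif_pos hx, dif_pos (star_mem_face hx), ← χ.map_star']
      rfl
    · rw [dif_neg hx, dif_neg (fun h => hx (star_mem_face_iff.1 h)), map_zero]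
  ne_zero' h := χ.ne_zero' <| funext fun x => by
    have := congrFun h x
    rwa [dif_pos x.2] at this

theorem Character.extendFace_coe {s : S} (χ : Character (face s)) (x : face s) :
    χ.extendFace (x : S) = χ x := dif_pos x.2

theorem Character.extendFace_of_notMem {s x : S} (χ : Character (face s)) (hx : x ∉ face s) :
    χ.extendFace x = 0 := dif_neg hx

/-- The character with constant value `1`. -/
def Character.one (M : Type*) [AddCommMonoid M] [StarAddMonoid M] : Character M where
  toFun _ := 1
  map_add' _ _ := (one_mul 1).symm
  map_star' _ := (map_one _).symm
  ne_zero' h := one_ne_zero (congrFun h 0)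

/-- The indicator function of the face of `s` is a character. -/
theorem mem_face_of_forall_character {s t : S} (h : ∀ σ : Character S, σ s = σ t) :
    t ∈ face s := by
  by_contra ht
  have h1 := h (Character.one (face s)).extendFace
  rw [Character.extendFace_of_notMem _ ht,
    Character.extendFace_coe _ ⟨s, self_mem_face s⟩] at h1
  exact one_ne_zero h1

end Face

end StarSemigroup

namespace StarSemigroup

/-! ### Null space of a positive definite function in the semigroup algebra -/

section NullSpace

/-- The monomial of `u` in the semigroup algebra. -/
noncomputable def mon {S : Type*} (u : S) : AddMonoidAlgebra ℂ S := AddMonoidAlgebra.single u 1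

theorem mon_zero {S : Type*} [AddCommMonoid S] : mon (0 : S) = 1 := rfl

theorem mon_add {S : Type*} [AddCommMonoid S] (u v : S) : mon (u + v) = mon u * mon v := by
  rw [mon, mon, mon, AddMonoidAlgebra.single_mul_single, one_mul]

theorem mon_nsmul {S : Type*} [AddCommMonoid S] (k : ℕ) (u : S) : mon (k • u) = mon u ^ k := by
  induction k with
  | zero => rw [zero_nsmul, pow_zero, mon_zero]
  | succ k ih => rw [succ_nsmul, pow_succ, mon_add, ih]

variable {S : Type*} [AddCommMonoid S] [StarAddMonoid S]

/-- The linear map from the semigroup algebra to `H^φ` that sends `s` to `K_s`. -/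
noncomputable def kerMap (φ : PosDefFun S) : AddMonoidAlgebra ℂ S →ₗ[ℂ] HilbertSpace φ :=
  Finsupp.linearCombination ℂ (kerVec φ) ∘ₗ (AddMonoidAlgebra.coeffLinearEquiv ℂ).toLinearMap

variable (φ : PosDefFun S)

theorem kerMap_mon (u : S) : kerMap φ (mon u) = kerVec φ u := by
  simp [kerMap, mon, AddMonoidAlgebra.coeffLinearEquiv]

variable {φ}

/-- Multiplication by `u*` is a formal adjoint of multiplication by `u`; this makes the null space
of `kerMap` an ideal. -/
theorem inner_kerMap_mon_mul (u : S) (a b : AddMonoidAlgebra ℂ S) :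
    inner ℂ (kerMap φ (mon u * a)) (kerMap φ b)
      = inner ℂ (kerMap φ a) (kerMap φ (mon (star u) * b)) := by
  induction a using AddMonoidAlgebra.induction_on with
  | of s =>
    induction b using AddMonoidAlgebra.induction_on with
    | of t =>
      change inner ℂ (kerMap φ (mon u * mon s)) (kerMap φ (mon t))
        = inner ℂ (kerMap φ (mon s)) (kerMap φ (mon (star u) * mon t))
      rw [← mon_add, ← mon_add, kerMap_mon, kerMap_mon, kerMap_mon, kerMap_mon, inner_kerVec,
        inner_kerVec, kerVec_apply, kerVec_apply, star_add, star_star]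
      exact congrArg φ.1 (by abel)
    | add b b' h h' => rw [mul_add, map_add, map_add, inner_add_right, inner_add_right, h, h']
    | smul r b h => rw [mul_smul_comm, map_smul, map_smul, inner_smul_right, inner_smul_right, h]
  | add a a' h h' => rw [mul_add, map_add, map_add, inner_add_left, inner_add_left, h, h']
  | smul r a h => rw [mul_smul_comm, map_smul, map_smul, inner_smul_left, inner_smul_left, h]

theorem kerMap_mon_mul_eq_zero {a : AddMonoidAlgebra ℂ S} (h : kerMap φ a = 0) (u : S) :
    kerMap φ (mon u * a) = 0 := by
  rw [← inner_self_eq_zero (𝕜 := ℂ), inner_kerMap_mon_mul, h, inner_zero_left]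

theorem kerMap_mul_eq_zero {a : AddMonoidAlgebra ℂ S} (h : kerMap φ a = 0)
    (b : AddMonoidAlgebra ℂ S) : kerMap φ (b * a) = 0 := by
  induction b using AddMonoidAlgebra.induction_on with
  | of s => exact kerMap_mon_mul_eq_zero h s
  | add b b' h h' => rw [add_mul, map_add, h, h', add_zero]
  | smul r b h => rw [smul_mul_assoc, map_smul, h, smul_zero]

theorem kerMap_of_star_mul_self {u : S} {a : AddMonoidAlgebra ℂ S}
    (h : kerMap φ (mon (star u + u) * a) = 0) : kerMap φ (mon u * a) = 0 := by
  rw [← inner_self_eq_zero (𝕜 := ℂ), inner_kerMap_mon_mul, ← mul_assoc, ← mon_add, h,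
    inner_zero_right]

/-- Since `w` is self-adjoint, `kerMap_of_star_mul_self` halves an even multiple; an odd multiple is
first padded by one more `w`. -/
theorem kerMap_of_nsmul {w : S} (hw : star w = w) {a : AddMonoidAlgebra ℂ S} (k : ℕ)
    (h : kerMap φ (mon (k • w) * a) = 0) : kerMap φ (mon w * a) = 0 := by
  induction k using Nat.strong_induction_on with
  | _ k ih =>
    by_cases hk : k ≤ 1
    · have := kerMap_mon_mul_eq_zero h ((1 - k) • w)
      rwa [← mul_assoc, ← mon_add, ← add_nsmul, Nat.sub_add_cancel hk, one_nsmul] at this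
    -- Here `m` is `k / 2` rounded up and `r` is `0` or `1`.
    · obtain ⟨m, r, hm, hr⟩ : ∃ m r : ℕ, m < k ∧ r + k = m + m :=
        ⟨(k + 1) / 2, (k + 1) / 2 + (k + 1) / 2 - k, by omega, by omega⟩
      refine ih m hm (kerMap_of_star_mul_self ?_)
      have := kerMap_mon_mul_eq_zero h (r • w)
      rw [← mul_assoc, ← mon_add, ← add_nsmul, hr, add_nsmul] at this
      rwa [star_nsmul, hw]

theorem star_add_star_self (s : S) : star (s + star s) = s + star s := by
  rw [star_add, star_star, add_comm]

theorem kerMap_of_mem_face {s x : S} (hx : x ∈ face s) {a : AddMonoidAlgebra ℂ S}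
    (h : kerMap φ (mon x * a) = 0) : kerMap φ (mon (s + star s) * a) = 0 := by
  obtain ⟨y, k, e⟩ := hx
  refine kerMap_of_nsmul (star_add_star_self s) k ?_
  rw [← e, add_comm, mon_add, mul_assoc]
  exact kerMap_mon_mul_eq_zero h y

/-- Some multiple of `s + s*` is divisible by `x`, so killing by `x` gives killing by `s + s*`; the
resulting square of `s + s*` is reduced to a single factor. -/
theorem kerMap_cancel {s x : S} (hx : x ∈ face s) {a : AddMonoidAlgebra ℂ S}
    (h : kerMap φ (mon x * (mon (s + star s) * a)) = 0) :
    kerMap φ (mon (s + star s) * a) = 0 := by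
  have := kerMap_of_mem_face hx h
  rw [← mul_assoc, ← mon_add, ← two_nsmul] at this
  exact kerMap_of_nsmul (star_add_star_self s) 2 this

open Algebra in
theorem kerMap_congr {s : S} {x y : face s}
    (h : GrothendieckAddGroup.of x = GrothendieckAddGroup.of y) (a : AddMonoidAlgebra ℂ S) :
    kerMap φ (mon (x : S) * (mon (s + star s) * a))
      = kerMap φ (mon (y : S) * (mon (s + star s) * a)) := by
  obtain ⟨c, hc⟩ := GrothendieckAddGroup.of_eq_of_iff.1 h
  have hc' : (c : S) + x = c + y := by
    simpa [add_comm] using congrArg Subtype.val hc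
  rw [← sub_eq_zero, ← map_sub, ← sub_mul, mul_left_comm]
  refine kerMap_cancel c.2 ?_
  rw [mul_left_comm, ← mul_assoc (mon (c : S)), mul_sub, ← mon_add, ← mon_add, hc', sub_self,
    zero_mul, mul_zero, map_zero]

open Algebra in
/-- On the range of `s + s*`, the operators of `s` and `t` agree if `s - t` is torsion and a
difference of elements `a + a*` of the Grothendieck group of the face of `s`: the quotient of the
two operators is then positive and of finite order. -/
theorem kerMap_mon_mul_eq {s : S} {x y a b : face s} {n : ℕ} (hn : 0 < n)
    (htors : n • (GrothendieckAddGroup.of x - .of y) = 0)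
    (hpos : GrothendieckAddGroup.of x - .of y
      = GrothendieckAddGroup.of (a + star a) - .of (b + star b)) (v : AddMonoidAlgebra ℂ S) :
    kerMap φ (mon (x : S) * (mon (s + star s) * v))
      = kerMap φ (mon (y : S) * (mon (s + star s) * v)) := by
  set w := s + star s with hw
  set z : AddMonoidAlgebra ℂ S := (mon (x : S) - mon (y : S)) * v with hz
  obtain ⟨m, rfl⟩ : ∃ m, n = m + 1 := ⟨n - 1, by omega⟩
  -- The geometric sum times `x - y` telescopes to `x ^ n - y ^ n`, which acts as zero by torsion.
  have h0 : kerMap φ ((∑ j ∈ Finset.range (m + 1), mon (x : S) ^ j * mon (y : S) ^ (m - j))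
      * (mon w * z)) = 0 := by
    have e : (∑ j ∈ Finset.range (m + 1), mon (x : S) ^ j * mon (y : S) ^ (m - j)) * (mon w * z)
        = (mon (x : S) ^ (m + 1) - mon (y : S) ^ (m + 1)) * (mon w * v) := by
      rw [← geom_sum₂_mul, hz, Nat.add_sub_cancel]
      ring
    have h1 : GrothendieckAddGroup.of ((m + 1) • x) = GrothendieckAddGroup.of ((m + 1) • y) := by
      rw [map_nsmul, map_nsmul, ← sub_eq_zero, ← nsmul_sub, htors]
    have h2 := kerMap_congr (φ := φ) h1 v
    rw [e, sub_mul, map_sub, ← mon_nsmul, ← mon_nsmul, sub_eq_zero]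
    exact h2
  -- The factor `m • (b + b*)` clears the negative terms of `hpos`: with `c = j • a + (m - j) • b`,
  -- the monomial becomes `c + c* + m • y`. Moving `c*` across the inner product, paired with `m •
  -- y`, leaves a squared norm.
  have h1 : ∀ j ∈ Finset.range (m + 1),
      inner ℂ (kerMap φ (mon (m • (b + star b) : face s).1
        * (mon (x : S) ^ j * mon (y : S) ^ (m - j) * (mon w * z))))
        (kerMap φ (mon (m • (y : S)) * (mon w * z)))
      = ((‖kerMap φ (mon (j • a + (m - j) • b + m • y : face s).1 * (mon w * z))‖ ^ 2 : ℝ) : ℂ) := by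
    intro j hj
    obtain ⟨i, rfl⟩ : ∃ i, m = j + i := ⟨m - j, by have := Finset.mem_range.1 hj; omega⟩
    rw [Nat.add_sub_cancel_left]
    have hG : GrothendieckAddGroup.of ((j + i) • (b + star b) + (j • x + i • y))
        = GrothendieckAddGroup.of (star (j • a + i • b) + ((j • a + i • b) + (j + i) • y)) := by
      have hx := eq_add_of_sub_eq hpos
      simp only [map_add, map_nsmul, star_add, star_nsmul] at hx ⊢
      rw [hx]
      module
    have h2 := kerMap_congr (φ := φ) hG z
    have e1 : mon ((j + i) • (b + star b) : face s).1
        * (mon (x : S) ^ j * mon (y : S) ^ i * (mon w * z))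
        = mon ((j + i) • (b + star b) + (j • x + i • y) : face s).1 * (mon w * z) := by
      rw [← mon_nsmul, ← mon_nsmul, ← mul_assoc, ← mon_add, ← mon_add]
      rfl
    have e2 : mon (j • a + i • b : face s).1 * (mon ((j + i) • (y : S)) * (mon w * z))
        = mon (j • a + i • b + (j + i) • y : face s).1 * (mon w * z) := by
      rw [← mul_assoc, ← mon_add]
      rfl
    rw [e1, h2, AddSubmonoid.coe_add, mon_add, mul_assoc, inner_kerMap_mon_mul, coe_star_face,
      star_star, e2, inner_self_eq_norm_sq_to_K, Complex.ofReal_pow]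
    rfl
  have h2 : ∑ j ∈ Finset.range (m + 1),
      ‖kerMap φ (mon (j • a + (m - j) • b + m • y : face s).1 * (mon w * z))‖ ^ 2 = 0 := by
    have h3 : inner ℂ (kerMap φ (mon (m • (b + star b) : face s).1
        * ((∑ j ∈ Finset.range (m + 1), mon (x : S) ^ j * mon (y : S) ^ (m - j)) * (mon w * z))))
        (kerMap φ (mon (m • (y : S)) * (mon w * z))) = 0 := by
      rw [kerMap_mul_eq_zero h0, inner_zero_left]
    rw [Finset.sum_mul, Finset.mul_sum, map_sum, sum_inner, Finset.sum_congr rfl h1] at h3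
    exact_mod_cast h3
  -- One vanishing term suffices, here `j = 0`; its monomial lies in the face and can be cancelled.
  have h3 := (Finset.sum_eq_zero_iff_of_nonneg fun _ _ => by positivity).1 h2 0 (by simp)
  have h4 := kerMap_cancel (Subtype.prop _) (norm_eq_zero.1 (pow_eq_zero_iff two_ne_zero |>.1 h3))
  rw [← sub_eq_zero, ← map_sub, ← sub_mul, mul_left_comm]
  exact h4

/-- With `y = s - t`, the face argument gives that `s + s*` kills `y`. Hence `s*` kills `y`, and so
does `t*` because the faces agree. Expanding one factor of `‖y‖²` and passing to adjoints leaves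
only these two terms. -/
theorem kerVec_eq_of_forall_character {s t : S} (h : ∀ σ : Character S, σ s = σ t) :
    kerVec φ s = kerVec φ t := by
  have ht := mem_face_of_forall_character h
  have hs := mem_face_of_forall_character fun σ => (h σ).symm
  have hF : ∀ σ : Character (face s), σ ⟨s, self_mem_face s⟩ = σ ⟨t, ht⟩ := fun σ => by
    have := h σ.extendFace
    rwa [σ.extendFace_coe ⟨s, self_mem_face s⟩, σ.extendFace_coe ⟨t, ht⟩] at this
  obtain ⟨n, hn, h1⟩ := exists_nsmul_sub_eq_zero_of_forall_character hF
  obtain ⟨a, b, h2⟩ := exists_sub_eq_of_forall_character hF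
  have h3 := kerMap_mon_mul_eq (φ := φ) hn h1 h2 1
  rw [← sub_eq_zero, ← map_sub, ← sub_mul, mul_one, mul_comm] at h3
  change kerMap φ (mon (s + star s) * (mon s - mon t)) = 0 at h3
  set y := mon s - mon t with hy
  have h4 : kerMap φ (mon (star s) * y) = 0 :=
    kerMap_of_star_mul_self (by rwa [star_star])
  have h5 : kerMap φ (mon (star t) * y) = 0 := by
    refine kerMap_of_star_mul_self ?_
    rw [star_star]
    exact kerMap_of_mem_face (star_mem_face hs) h4
  rw [← sub_eq_zero, ← kerMap_mon, ← kerMap_mon, ← map_sub, ← hy,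
    ← inner_self_eq_zero (𝕜 := ℂ)]
  nth_rewrite 1 [hy]
  rw [← mul_one (mon s), ← mul_one (mon t), map_sub, inner_sub_left, inner_kerMap_mon_mul,
    inner_kerMap_mon_mul, h4, h5, sub_self]

/-- Positive definite functions are constant on the classes of `∼`. -/
theorem PosDefFun.apply_eq_of_forall_character (φ : PosDefFun S) {s t : S}
    (h : ∀ σ : Character S, σ s = σ t) : φ.1 s = φ.1 t := by
  have h1 : kerVec φ (star s) = kerVec φ (star t) :=
    kerVec_eq_of_forall_character fun σ => by rw [σ.map_star', σ.map_star', h σ]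
  have h2 := congrArg (fun f : HilbertSpace φ => f 0) h1
  simpa only [kerVec_apply, star_star, add_zero] using h2

end NullSpace

end StarSemigroup

/-- Two total families in Hilbert spaces with the same Gram matrix are unitarily equivalent. -/
theorem exists_linearIsometryEquiv_of_inner_eq {ι H K : Type*} [NormedAddCommGroup H]
    [InnerProductSpace ℂ H] [CompleteSpace H] [NormedAddCommGroup K] [InnerProductSpace ℂ K]
    [CompleteSpace K] {v : ι → H} {w : ι → K}
    (hv : (Submodule.span ℂ (Set.range v)).topologicalClosure = ⊤)
    (hw : (Submodule.span ℂ (Set.range w)).topologicalClosure = ⊤)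
    (h : ∀ i j, inner ℂ (v i) (v j) = inner ℂ (w i) (w j)) :
    ∃ U : H ≃ₗᵢ[ℂ] K, ∀ i, U (v i) = w i := by
  have hdv : DenseRange (Finsupp.linearCombination ℂ v) := by
    rw [← Finsupp.range_linearCombination] at hv
    exact Submodule.dense_iff_topologicalClosure_eq_top.2 hv
  have hdw : DenseRange (Finsupp.linearCombination ℂ w) := by
    rw [← Finsupp.range_linearCombination] at hw
    exact Submodule.dense_iff_topologicalClosure_eq_top.2 hw
  have hnorm : ∀ a : ι →₀ ℂ, ‖Finsupp.linearCombination ℂ w (LinearEquiv.refl ℂ _ a)‖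
      = ‖Finsupp.linearCombination ℂ v a‖ := by
    intro a
    have : inner ℂ (Finsupp.linearCombination ℂ w a) (Finsupp.linearCombination ℂ w a)
        = inner ℂ (Finsupp.linearCombination ℂ v a) (Finsupp.linearCombination ℂ v a) := by
      simp only [Finsupp.linearCombination_apply, Finsupp.sum, sum_inner, inner_sum,
        inner_smul_left, inner_smul_right, h]
    rw [LinearEquiv.refl_apply, norm_eq_sqrt_re_inner (𝕜 := ℂ), this,
      ← norm_eq_sqrt_re_inner (𝕜 := ℂ)]
  refine ⟨(LinearEquiv.refl ℂ (ι →₀ ℂ)).extendOfIsometry _ _ hdv hdw hnorm,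
    fun i => ?_⟩
  have := LinearEquiv.extendOfIsometry_eq (LinearEquiv.refl ℂ (ι →₀ ℂ)) _ _ hdv hdw hnorm (Finsupp.single i 1)
  simpa using this

namespace StarSemigroup

/-! ### Transport of kernels and moment functions between `S` and `S/∼` -/

section Transport

variable {S : Type*} [AddCommMonoid S] [StarAddMonoid S]

theorem span_kerVec_dense (φ : PosDefFun S) :
    (Submodule.span ℂ (Set.range (kerVec φ))).topologicalClosure = ⊤ := by
  rw [eq_top_iff, ← RKHS.kerFun_dense (HilbertSpace φ)]
  refine Submodule.topologicalClosure_mono (Submodule.span_le.2 ?_)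
  rintro _ ⟨s, c, rfl⟩
  have : RKHS.kerFun (HilbertSpace φ) s c = c • kerVec φ s := by
    rw [kerVec, ← map_smul, smul_eq_mul, mul_one]
  rw [this]
  exact Submodule.smul_mem _ _ (Submodule.subset_span ⟨s, rfl⟩)

/-- Expressing the kernel through the closed graph removes domains from the transport argument. -/
theorem mem_kerShiftAddOne_iff {u : S} {φ : PosDefFun S} {f : HilbertSpace φ} :
    f ∈ kerShiftAddOne u φ ↔ (f, -f) ∈ (shiftGraph u φ).topologicalClosure := by
  rw [← graph_shiftOp, (isClosable_shiftOp u φ).graph_closure_eq_closure_graph,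
    LinearPMap.mem_graph_iff]
  constructor
  · rintro ⟨hf, h⟩
    exact ⟨⟨f, hf⟩, rfl, eq_neg_of_add_eq_zero_left h⟩
  · rintro ⟨⟨g, hg⟩, rfl, h⟩
    exact ⟨hg, eq_neg_iff_add_eq_zero.1 h⟩

theorem cls_surjective : Function.Surjective (cls : S → SepQuotient S) :=
  AddCon.mk'_surjective

theorem cls_add (s t : S) : cls (s + t) = cls s + cls t := rfl

theorem cls_star (s : S) : cls (star s) = star (cls s) := rfl

theorem cls_eq_cls {s t : S} : cls s = cls t ↔ ∀ σ : Character S, σ s = σ t :=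
  (charCon S).eq

variable {φ : PosDefFun S} {ψ : PosDefFun (SepQuotient S)}

theorem exists_unitary_kerVec_cls (h : ∀ s, φ.1 s = ψ.1 (cls s)) :
    ∃ U : HilbertSpace ψ ≃ₗᵢ[ℂ] HilbertSpace φ, ∀ s, U (kerVec ψ (cls s)) = kerVec φ s := by
  refine exists_linearIsometryEquiv_of_inner_eq (v := fun s => kerVec ψ (cls s)) ?_
    (span_kerVec_dense φ) fun s t => ?_
  · rw [← span_kerVec_dense ψ, ← cls_surjective.range_comp]
    rfl
  · rw [inner_kerVec, inner_kerVec, kerVec_apply, kerVec_apply, h, cls_add, cls_star]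

theorem finiteDimensional_kerShiftAddOne_iff (u : S) (h : ∀ s, φ.1 s = ψ.1 (cls s)) :
    FiniteDimensional ℂ (kerShiftAddOne u φ)
      ↔ FiniteDimensional ℂ (kerShiftAddOne (cls u) ψ) := by
  obtain ⟨U, hU⟩ := exists_unitary_kerVec_cls h
  let E : (HilbertSpace ψ × HilbertSpace ψ) ≃L[ℂ] (HilbertSpace φ × HilbertSpace φ) :=
    U.toContinuousLinearEquiv.prodCongr U.toContinuousLinearEquiv
  have hgraph : (shiftGraph u φ : Set (HilbertSpace φ × HilbertSpace φ))
      = E '' (shiftGraph (cls u) ψ) := by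
    have : shiftGraph u φ = (shiftGraph (cls u) ψ).map E.toLinearEquiv.toLinearMap := by
      rw [shiftGraph, shiftGraph, Submodule.map_span, ← Set.range_comp,
        ← cls_surjective.range_comp]
      congr 2
      funext s
      exact Prod.ext (hU s).symm (hU (s + u)).symm
    rw [this]
    rfl
  have hmem : ∀ p, E p ∈ (shiftGraph u φ).topologicalClosure
      ↔ p ∈ (shiftGraph (cls u) ψ).topologicalClosure := by
    intro p
    rw [← SetLike.mem_coe, ← SetLike.mem_coe, Submodule.topologicalClosure_coe,
      Submodule.topologicalClosure_coe, hgraph, ← E.image_closure,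
      E.injective.mem_set_image]
  have hker : kerShiftAddOne u φ
      = (kerShiftAddOne (cls u) ψ).map U.toLinearEquiv.toLinearMap := by
    ext f
    obtain ⟨g, rfl⟩ := U.surjective f
    have e : (U g, -U g) = E (g, -g) := Prod.ext rfl (map_neg U g).symm
    rw [mem_kerShiftAddOne_iff, e, hmem, ← mem_kerShiftAddOne_iff]
    exact (Function.Injective.mem_set_image (f := U) U.injective).symm
  rw [hker]
  exact (Module.Finite.equiv_iff (U.toLinearEquiv.submoduleMap _)).symm

theorem isPosDef_comp_cls_iff {ψ : SepQuotient S → ℂ} :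
    IsPosDef (fun s => ψ (cls s)) ↔ IsPosDef ψ := by
  refine ⟨fun h N s ξ => ?_, fun h N s ξ => h N (fun i => cls (s i)) ξ⟩
  obtain ⟨r, rfl⟩ := cls_surjective.comp_left s
  exact h N r ξ

theorem PosDefFun.exists_eq_comp_cls (φ : PosDefFun S) :
    ∃ ψ : SepQuotient S → ℂ, φ.1 = fun s => ψ (cls s) :=
  ⟨Quotient.lift φ.1 fun _ _ h => φ.apply_eq_of_forall_character h, rfl⟩

theorem measurable_character {α : Type*} [MeasurableSpace α] {f : α → Character S}
    (h : ∀ s, Measurable fun a => f a s) : Measurable f := by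
  rw [measurable_iff_comap_le, instMeasurableSpaceCharacter, MeasurableSpace.comap_iSup]
  refine iSup_le fun s => ?_
  rw [MeasurableSpace.comap_comp, ← BorelSpace.measurable_eq (α := ℂ)]
  exact (h s).comap_le

open MeasureTheory in
-- The push-forward along `q` represents `ψ`, since each evaluation at `t` composed with `q` is an
-- evaluation at some `s`. This form serves both directions between `S` and `S/∼`.
theorem IsMoment.map {T : Type*} [AddCommMonoid T] [StarAddMonoid T] {φ : S → ℂ} (hφ : IsMoment φ)
    {ψ : T → ℂ} {q : Character S → Character T}
    (h : ∀ t, ∃ s, (∀ σ, q σ t = σ s) ∧ ψ t = φ s) : IsMoment ψ := by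
  obtain ⟨μ, hμ, hint⟩ := hφ
  have hq : Measurable q := measurable_character fun t => by
    obtain ⟨s, hs, -⟩ := h t
    simpa only [hs] using Character.measurable_eval s
  refine ⟨μ.map q, fun t => ?_, fun t => ?_⟩
  · obtain ⟨s, hs, -⟩ := h t
    rw [memLp_map_measure_iff (Character.measurable_eval t).aestronglyMeasurable hq.aemeasurable]
    exact (hμ s).congr_norm ((Character.measurable_eval t).comp hq).aestronglyMeasurable
      (.of_forall fun σ => by simp [hs])
  · obtain ⟨s, hs, e⟩ := h t
    rw [integral_map hq.aemeasurable (Character.measurable_eval t).aestronglyMeasurable, e, hint]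
    simp only [hs]

/-- The character of `S` induced by a character of `S/∼`. -/
def Character.compCls (χ : Character (SepQuotient S)) : Character S where
  toFun s := χ (cls s)
  map_add' s t := χ.map_add' (cls s) (cls t)
  map_star' s := χ.map_star' (cls s)
  ne_zero' h := χ.ne_zero' <| funext fun x => by
    obtain ⟨s, rfl⟩ := cls_surjective x
    exact congrFun h s

/-- The character of `S/∼` induced by a character of `S`. -/
def Character.descend (χ : Character S) : Character (SepQuotient S) where
  toFun := Quotient.lift χ.toFun fun _ _ h => h χ
  map_add' := by
    rintro ⟨s⟩ ⟨t⟩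
    exact χ.map_add' s t
  map_star' := by
    rintro ⟨s⟩
    exact χ.map_star' s
  ne_zero' h := χ.ne_zero' <| funext fun s => congrFun h (cls s)

theorem isMoment_comp_cls_iff {ψ : SepQuotient S → ℂ} :
    IsMoment (fun s => ψ (cls s)) ↔ IsMoment ψ := by
  refine ⟨fun h => h.map (q := Character.descend) fun t => ?_,
    fun h => h.map (q := Character.compCls) fun s => ⟨cls s, fun _ => rfl, rfl⟩⟩
  obtain ⟨s, rfl⟩ := cls_surjective t
  exact ⟨s, fun _ => rfl, rfl⟩

end Transport

end StarSemigroup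

open StarSemigroup
theorem corollary3 {S : Type*} [AddCommMonoid S] [StarAddMonoid S] (u : S)
    (hu2 : cls (2 • u) = 0) (hustar : cls u = cls (star u)) :
    ((∀ φ : PosDefFun S, FiniteDimensional ℂ (kerShiftAddOne u φ)) ↔
      (∀ ψ : PosDefFun (SepQuotient S), FiniteDimensional ℂ (kerShiftAddOne (cls u) ψ))) ∧
    ((∀ (φ : S → ℂ) (hφ : IsMoment φ),
        FiniteDimensional ℂ (kerShiftAddOne u ⟨φ, hφ.isPosDef⟩)) ↔
      (∀ (ψ : SepQuotient S → ℂ) (hψ : IsMoment ψ),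
        FiniteDimensional ℂ (kerShiftAddOne (cls u) ⟨ψ, hψ.isPosDef⟩))) := by
  refine ⟨⟨fun h ψ => ?_, fun h φ => ?_⟩, ⟨fun h ψ hψ => ?_, fun h φ hφ => ?_⟩⟩
  · exact (finiteDimensional_kerShiftAddOne_iff u fun _ => rfl).1
      (h ⟨fun s => ψ.1 (cls s), isPosDef_comp_cls_iff.2 ψ.2⟩)
  · obtain ⟨ψ, hψ⟩ := φ.exists_eq_comp_cls
    exact (finiteDimensional_kerShiftAddOne_iff u fun s => congrFun hψ s).2
      (h ⟨ψ, isPosDef_comp_cls_iff.1 (hψ ▸ φ.2)⟩)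
  · exact (finiteDimensional_kerShiftAddOne_iff u fun _ => rfl).1
      (h (fun s => ψ (cls s)) (isMoment_comp_cls_iff.2 hψ))
  · obtain ⟨ψ, rfl⟩ := PosDefFun.exists_eq_comp_cls ⟨φ, hφ.isPosDef⟩
    exact (finiteDimensional_kerShiftAddOne_iff u fun _ => rfl).2
      (h ψ (isMoment_comp_cls_iff.1 hφ))
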